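/- Let $M\ge 2$, $N\ge 1$, $D\ge 0$ be integers, let $\rho:\mathbb{R}\to[0,\infty)$ be $L_\rho$-Lipschitz, and let $C_1,C_3,C_4,d_{min}$ be real constants. Let $\mathcal{X}\subseteq\{x\in\mathbb{R}^D:\|x\|_2\le C_1\}$ be the set of inputs and let $\mathcal{Q}$ be a probability distribution of pairs $(x,y)$ with $x\in\mathcal{X}$ and $y\in\{-1,1\}$ almost surely. Let $\mathcal{F}$ be the class of all functions $f(x)=\sum_{m=1}^M v_m\phi_m(x)$, $\phi_m(x)=\rho(w_m^Tx)$, with $w_m\in\mathbb{R}^D$, $\|w_m\|_2\le C_3$, $v\in\mathbb{R}^M$, $\|v\|_\infty\le C_4$, such that for every $x\in\mathcal{X}$ $$\frac{1}{2M(M-1)}\sum_{n\ne m}(\phi_n(x)-\phi_m(x))^2\ \ge\ d_{min}^2 ,$$ the sum being over ordered pairs $(n,m)$ with $n\neq m$. With the logistic loss $l(f(x),y)=\log(1+e^{-yf(x)})$, put $L(f)=\mathbb{E}_{(x,y)\sim\mathcal{Q}}[l(f(x),y)]$ and, for a sample $(x_1,y_1),\dots,(x_N,y_N)$ drawn i.i.d.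 from $\mathcal{Q}$, $\hat L(f)=\frac1N\sum_{i=1}^N l(f(x_i),y_i)$. Let $f^*\in\mathcal{F}$ minimize $L$ over $\mathcal{F}$. Then for every $\delta\in(0,1)$, with probability at least $1-\delta$ over the sample, every $\hat f\in\mathcal{F}$ that minimizes $\hat L$ over $\mathcal{F}$ satisfies $$L(\hat f)-L(f^*)\ \le\ \frac{A}{(1+e^{-\sqrt{\mathcal{J}}})\sqrt{N}}+\log\!\left(1+e^{\sqrt{\mathcal{J}}}\right)\sqrt{\frac{2\log(2/\delta)}{N}},$$ where $C_5=L_\rho C_1C_3+\rho(0)$, $\mathcal{J}=C_4^2\left(MC_5^2+M(M-1)(C_5^2-d_{min}^2)\right)$ and $A=4\left(2L_\rho C_1C_3C_4+C_4|\rho(0)|\right)M$. -/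

import Mathlib

open MeasureTheory

namespace DiverseNet

noncomputable section

/-- Input space `ℝ^D` with the Euclidean norm. -/
abbrev Input (D : ℕ) : Type := EuclideanSpace ℝ (Fin D)

/-- The feature `φ_m(x) = ρ(w_mᵀ x)` computed by the `m`-th hidden unit. -/
def feature {D M : ℕ} (ρ : ℝ → ℝ) (W : Fin M → Input D) (m : Fin M) (x : Input D) : ℝ :=
  ρ (inner ℝ (W m) x)

/-- The network `f(x) = ∑ v_m φ_m(x)` with one hidden layer of `M` units. -/
def network {D M : ℕ} (ρ : ℝ → ℝ) (W : Fin M → Input D) (v : Fin M → ℝ) (x : Input D) : ℝ :=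
  ∑ m, v m * feature ρ W m x

/-- Feature diversity at the input `x`:
`1 / (2 M (M - 1)) * ∑_{n ≠ m} (φ_n(x) - φ_m(x))²`, summed over ordered pairs. -/
def diversity {D M : ℕ} (ρ : ℝ → ℝ) (W : Fin M → Input D) (x : Input D) : ℝ :=
  1 / (2 * (M : ℝ) * ((M : ℝ) - 1)) *
    ∑ p ∈ (Finset.univ : Finset (Fin M)).offDiag,
      (feature ρ W p.1 x - feature ρ W p.2 x) ^ 2

/-- The hypothesis class: networks with hidden weights `‖w_m‖₂ ≤ C₃`, output weights
`‖v‖_∞ ≤ C₄` (the norm of `Fin M → ℝ` is the sup norm), whose feature diversity is at least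
`d²` at every admissible input `x ∈ X`. -/
def hypothesisClass {D : ℕ} (M : ℕ) (ρ : ℝ → ℝ) (X : Set (Input D)) (C₃ C₄ d : ℝ) :
    Set (Input D → ℝ) :=
  {f | ∃ (W : Fin M → Input D) (v : Fin M → ℝ),
    (∀ m, ‖W m‖ ≤ C₃) ∧ ‖v‖ ≤ C₄ ∧ (∀ x ∈ X, d ^ 2 ≤ diversity ρ W x) ∧ f = network ρ W v}

/-- The logistic loss of the prediction `t` for the label `y`. -/
def logisticLoss (t y : ℝ) : ℝ := Real.log (1 + Real.exp (-(y * t)))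

/-- Expected risk `L(f) = E_{(x,y) ∼ Q} l(f(x), y)`. -/
def risk {D : ℕ} (Q : Measure (Input D × ℝ)) (f : Input D → ℝ) : ℝ :=
  ∫ z, logisticLoss (f z.1) z.2 ∂Q

/-- Empirical risk of `f` on the sample `S = ((x_1, y_1), …, (x_N, y_N))`. -/
def empiricalRisk {D N : ℕ} (S : Fin N → Input D × ℝ) (f : Input D → ℝ) : ℝ :=
  1 / (N : ℝ) * ∑ i, logisticLoss (f (S i).1) (S i).2

/-- `C₅ = L_ρ C₁ C₃ + ρ(0)`. -/
def constC₅ (ρ : ℝ → ℝ) (L C₁ C₃ : ℝ) : ℝ := L * C₁ * C₃ + ρ 0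

/-- `J = C₄² (M C₅² + M (M - 1) (C₅² - d²))`. -/
def constJ (M : ℕ) (ρ : ℝ → ℝ) (L C₁ C₃ C₄ d : ℝ) : ℝ :=
  C₄ ^ 2 * ((M : ℝ) * constC₅ ρ L C₁ C₃ ^ 2 +
    (M : ℝ) * ((M : ℝ) - 1) * (constC₅ ρ L C₁ C₃ ^ 2 - d ^ 2))

/-- `A = 4 (2 L_ρ C₁ C₃ C₄ + C₄ |ρ(0)|) M`. -/
def constA (M : ℕ) (ρ : ℝ → ℝ) (L C₁ C₃ C₄ : ℝ) : ℝ :=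
  4 * (2 * L * (C₁ * C₃ * C₄) + C₄ * |ρ 0|) * (M : ℝ)

end

end DiverseNet

/-! Empirical minimality gives $L(\hat f)-L(f^*)\le (L-\hat L)(\hat f)-(L-\hat L)(f^*)$, so it
suffices to bound $\sup_f (L-\hat L)(f)-(L-\hat L)(f^*)$ with high probability. The subtracted term
is centered, so the mean is at most twice the Rademacher complexity of the losses
(`integral_iSup_le_rademacher`), and McDiarmid's inequality (`hasSubgaussianMGF_of_update_sub_le`)
controls the fluctuation. Working with this single one-sided process leaves slack: a factor 2 in the
first term, and $\log(1/\delta)$ in place of $\log(2/\delta)$.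

Diversity enters only through the output bound $|f|\le\sqrt{\mathcal J}$ (`abs_network_le`): a lower
bound on pairwise differences forces $(\sum_m\phi_m)^2$ below its trivial bound $M^2C_5^2$. The
output bound fixes both the range $\log(1+e^{\sqrt{\mathcal J}})$ of the loss and its Lipschitz
constant $(1+e^{-\sqrt{\mathcal J}})^{-1}$. Contraction (`sum_iSup_signSum_le`) removes first the
loss, then $\rho$, leaving linear functionals, which are handled by Cauchy–Schwarz.

Suprema are taken over finite classes only. A countable class is an increasing union of these, and
continuity in the parameters passes from a dense sequence to the whole class. -/

namespace DiverseNet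

/-! ### Rademacher averages: contraction and linear classes. -/

section Rademacher

/-- Splitting off the first sign in a sum over sign vectors. -/
theorem sum_sign_succ {A : Type*} [AddCommMonoid A] {n : ℕ} (F : (Fin (n + 1) → ℤˣ) → A) :
    ∑ ε, F ε = ∑ ε : Fin n → ℤˣ, (F (Fin.cons 1 ε) + F (Fin.cons (-1) ε)) := by
  rw [← (Fin.consEquiv (fun _ => ℤˣ)).sum_comp, Fintype.sum_prod_type,
    UnitsInt.univ,
    Finset.sum_pair (by decide), ← Finset.sum_add_distrib]
  rfl

theorem sum_sign_neg {A : Type*} [AddCommMonoid A] {n : ℕ} (F : (Fin n → ℤˣ) → A) :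
    ∑ ε, F (-ε) = ∑ ε, F ε :=
  _root_.Equiv.sum_comp (Equiv.neg (Fin n → ℤˣ)) F

theorem card_sign (n : ℕ) : Fintype.card (Fin n → ℤˣ) = 2 ^ n := by
  simp

theorem le_iSup_of_finite {ι : Type*} [Finite ι] (f : ι → ℝ) (i : ι) : f i ≤ ⨆ i, f i :=
  le_ciSup (Set.finite_range f).bddAbove i

/-- The value at a sample sign vector `ε` of the Rademacher process `∑ j, ε j * u j`. -/
def signSum {n : ℕ} (ε : Fin n → ℤˣ) (u : Fin n → ℝ) : ℝ := ∑ j, ((ε j : ℤ) : ℝ) * u j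

theorem signSum_cons {n : ℕ} (s : ℤˣ) (ε : Fin n → ℤˣ) (u : Fin (n + 1) → ℝ) :
    signSum (Fin.cons s ε) u = ((s : ℤ) : ℝ) * u 0 + signSum ε (fun j => u j.succ) := by
  simp [signSum, Fin.sum_univ_succ]

theorem signSum_neg {n : ℕ} (ε : Fin n → ℤˣ) (u : Fin n → ℝ) :
    signSum (-ε) u = -signSum ε u := by
  simp [signSum]

theorem signSum_const_mul {n : ℕ} (ε : Fin n → ℤˣ) (c : ℝ) (u : Fin n → ℝ) :
    signSum ε (fun j => c * u j) = c * signSum ε u := by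
  simp only [signSum, Finset.mul_sum]
  exact Finset.sum_congr rfl fun _ _ => by ring

theorem signSum_add {n : ℕ} (ε : Fin n → ℤˣ) (u w : Fin n → ℝ) :
    signSum ε (fun j => u j + w j) = signSum ε u + signSum ε w := by
  simp only [signSum, ← Finset.sum_add_distrib, mul_add]

/-- One-coordinate case of contraction. If `i` and `k` attain the suprema on the left, the left side
is `b i + b k + (u i - u k)`, at most `b i + b k + |w i - w k|`; the sign of `w i - w k` decides
which of `i`, `k` is tested in which supremum on the right. -/
theorem iSup_add_iSup_sub_le {ι : Type*} [Finite ι] [Nonempty ι] (b u w : ι → ℝ)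
    (h : ∀ i k, |u i - u k| ≤ |w i - w k|) :
    (⨆ i, (b i + u i)) + (⨆ i, (b i - u i)) ≤ (⨆ i, (b i + w i)) + (⨆ i, (b i - w i)) := by
  obtain ⟨i, hi⟩ := exists_eq_ciSup_of_finite (f := fun i => b i + u i)
  obtain ⟨k, hk⟩ := exists_eq_ciSup_of_finite (f := fun i => b i - u i)
  rw [← hi, ← hk]
  have h1 := le_iSup_of_finite (fun i => b i + w i) i
  have h2 := le_iSup_of_finite (fun i => b i + w i) k
  have h3 := le_iSup_of_finite (fun i => b i - w i) i
  have h4 := le_iSup_of_finite (fun i => b i - w i) k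
  have h5 := (le_abs_self _).trans (h i k)
  rcases abs_cases (w i - w k) with ⟨h6, -⟩ | ⟨h6, -⟩ <;> linarith

/-- The Ledoux–Talagrand contraction principle, for a finite index set. -/
theorem sum_iSup_signSum_le {ι : Type*} [Finite ι] [Nonempty ι] {n : ℕ} (a : ι → ℝ)
    (u w : ι → Fin n → ℝ) (h : ∀ j i k, |u i j - u k j| ≤ |w i j - w k j|) :
    ∑ ε : Fin n → ℤˣ, ⨆ i, (a i + signSum ε (u i)) ≤
      ∑ ε : Fin n → ℤˣ, ⨆ i, (a i + signSum ε (w i)) := by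
  induction n generalizing a with
  | zero => simp [signSum]
  | succ n ih =>
    rw [sum_sign_succ, sum_sign_succ]
    -- The offset `a` absorbs the term of coordinate 0, so induction replaces `u` by `w` in the
    -- other coordinates. For each fixed `ε` the two values of the first sign then form the pair of
    -- suprema of `iSup_add_iSup_sub_le`.
    have h1 := ih (fun i => a i + u i 0) (fun i j => u i j.succ) (fun i j => w i j.succ)
      (fun j => h j.succ)
    have h2 := ih (fun i => a i - u i 0) (fun i j => u i j.succ) (fun i j => w i j.succ)
      (fun j => h j.succ)
    calc _ = ∑ ε : Fin n → ℤˣ, (⨆ i, (a i + u i 0 + signSum ε fun j => u i j.succ)) +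
          ∑ ε : Fin n → ℤˣ, (⨆ i, (a i - u i 0 + signSum ε fun j => u i j.succ)) := by
          rw [← Finset.sum_add_distrib]
          simp [signSum_cons, add_assoc, sub_eq_add_neg]
      _ ≤ _ := add_le_add h1 h2
      _ = ∑ ε : Fin n → ℤˣ, ((⨆ i, (a i + (signSum ε fun j => w i j.succ) + u i 0)) +
          ⨆ i, (a i + (signSum ε fun j => w i j.succ) - u i 0)) := by
          rw [← Finset.sum_add_distrib]
          simp only [add_right_comm, sub_add_eq_add_sub]
      _ ≤ ∑ ε : Fin n → ℤˣ, ((⨆ i, (a i + (signSum ε fun j => w i j.succ) + w i 0)) +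
          ⨆ i, (a i + (signSum ε fun j => w i j.succ) - w i 0)) :=
          Finset.sum_le_sum fun ε _ => iSup_add_iSup_sub_le _ _ _ (h 0)
      _ = _ := by
          simp only [signSum_cons, Units.val_one, Int.cast_one, one_mul, Units.val_neg,
            Int.cast_neg, neg_mul]
          refine Finset.sum_congr rfl fun ε _ => ?_
          congr 2 <;> ext i <;> ring

/-- The zero member `u i₀` makes the suprema at `ε` and at `-ε` nonnegative, so their sum dominates
the absolute value. Both have the same sum over all signs, whence the factor 2. -/
theorem sum_iSup_abs_signSum_le {ι : Type*} [Finite ι] {n : ℕ} (u w : ι → Fin n → ℝ) (i₀ : ι)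
    (h₀ : u i₀ = 0) (h : ∀ j i k, |u i j - u k j| ≤ |w i j - w k j|) :
    ∑ ε : Fin n → ℤˣ, ⨆ i, |signSum ε (u i)| ≤
      2 * ∑ ε : Fin n → ℤˣ, ⨆ i, signSum ε (w i) := by
  have : Nonempty ι := ⟨i₀⟩
  have key : ∀ ε : Fin n → ℤˣ, ⨆ i, |signSum ε (u i)| ≤
      (⨆ i, signSum ε (u i)) + ⨆ i, signSum (-ε) (u i) := by
    intro ε
    have hz : ∀ ε : Fin n → ℤˣ, 0 ≤ ⨆ i, signSum ε (u i) := fun ε => by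
      have := le_iSup_of_finite (fun i => signSum ε (u i)) i₀
      simpa [h₀, signSum] using this
    refine ciSup_le fun i => abs_le'.2 ⟨?_, ?_⟩
    · have := le_iSup_of_finite (fun i => signSum ε (u i)) i
      linarith [hz (-ε)]
    · have := le_iSup_of_finite (fun i => signSum (-ε) (u i)) i
      rw [← signSum_neg]
      linarith [hz ε]
  have hc := sum_iSup_signSum_le (fun _ => 0) u w h
  simp only [zero_add] at hc
  calc _ ≤ ∑ ε : Fin n → ℤˣ, ((⨆ i, signSum ε (u i)) + ⨆ i, signSum (-ε) (u i)) :=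
        Finset.sum_le_sum fun ε _ => key ε
    _ = 2 * ∑ ε : Fin n → ℤˣ, ⨆ i, signSum ε (u i) := by
        rw [Finset.sum_add_distrib, sum_sign_neg (fun ε => ⨆ i, signSum ε (u i)), two_mul]
    _ ≤ _ := by linarith

variable {E : Type*} [NormedAddCommGroup E] [InnerProductSpace ℝ E]

/-- Orthogonality of the signs, obtained by applying the parallelogram law to one sign at a time;
the translate `a` carries the induction. -/
theorem sum_norm_sq_sign {n : ℕ} (a : E) (x : Fin n → E) :
    ∑ ε : Fin n → ℤˣ, ‖a + ∑ j, ((ε j : ℤ) : ℝ) • x j‖ ^ 2 =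
      2 ^ n * (‖a‖ ^ 2 + ∑ j, ‖x j‖ ^ 2) := by
  induction n generalizing a with
  | zero => simp
  | succ n ih =>
    rw [sum_sign_succ, Finset.sum_add_distrib]
    have h1 := ih (a + x 0) (fun j => x j.succ)
    have h2 := ih (a - x 0) (fun j => x j.succ)
    have h3 := parallelogram_law_with_norm ℝ a (x 0)
    simp only [Fin.sum_univ_succ, Fin.cons_zero, Fin.cons_succ, Units.val_one, Int.cast_one,
      one_smul, Units.val_neg, Int.cast_neg, neg_smul, ← add_assoc, ← sub_eq_add_neg]
    rw [h1, h2, ← mul_add, pow_succ 2 n, mul_assoc]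
    congr 1
    linarith

/-- Cauchy–Schwarz over the `2 ^ n` sign vectors reduces this to the second moment. -/
theorem sum_norm_sign_le {n : ℕ} (x : Fin n → E) (C : ℝ) (hC : 0 ≤ C) (hx : ∀ j, ‖x j‖ ≤ C) :
    ∑ ε : Fin n → ℤˣ, ‖∑ j, ((ε j : ℤ) : ℝ) • x j‖ ≤ 2 ^ n * (C * √n) := by
  have h1 := sum_norm_sq_sign 0 x
  simp only [zero_add, norm_zero, ne_eq, OfNat.ofNat_ne_zero, not_false_eq_true, zero_pow] at h1
  have h2 := sq_sum_le_card_mul_sum_sq (s := Finset.univ)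
    (f := fun ε : Fin n → ℤˣ => ‖∑ j, ((ε j : ℤ) : ℝ) • x j‖)
  rw [h1, Finset.card_univ, card_sign] at h2
  have h3 : ∑ j, ‖x j‖ ^ 2 ≤ n * C ^ 2 := by
    calc _ ≤ ∑ _j : Fin n, C ^ 2 :=
          Finset.sum_le_sum fun j _ => pow_le_pow_left₀ (norm_nonneg _) (hx j) 2
      _ = _ := by simp
  refine abs_le_of_sq_le_sq' ?_ (by positivity) |>.2
  refine h2.trans ?_
  rw [mul_pow, mul_pow, Real.sq_sqrt (Nat.cast_nonneg n)]
  push_cast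
  rw [sq (2 ^ n : ℝ), mul_assoc, mul_comm (C ^ 2)]
  gcongr

/-- Rademacher complexity of linear functionals of norm at most `C'` on vectors of norm at
most `C`. -/
theorem sum_iSup_signSum_inner_le {ι : Type*} [Finite ι] [Nonempty ι] {n : ℕ} (w : ι → E)
    (x : Fin n → E) (C C' : ℝ) (hC : 0 ≤ C) (hC' : 0 ≤ C') (hx : ∀ j, ‖x j‖ ≤ C)
    (hw : ∀ i, ‖w i‖ ≤ C') :
    ∑ ε : Fin n → ℤˣ, ⨆ i, signSum ε (fun j => inner ℝ (w i) (x j)) ≤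
      2 ^ n * (C * C' * √n) := by
  calc _ ≤ ∑ ε : Fin n → ℤˣ, C' * ‖∑ j, ((ε j : ℤ) : ℝ) • x j‖ := by
        refine Finset.sum_le_sum fun ε _ => ciSup_le fun i => ?_
        have : signSum ε (fun j => inner ℝ (w i) (x j)) =
            inner ℝ (w i) (∑ j, ((ε j : ℤ) : ℝ) • x j) := by
          simp [signSum, inner_sum, inner_smul_right]
        rw [this]
        exact (real_inner_le_norm _ _).trans
          (mul_le_mul_of_nonneg_right (hw i) (norm_nonneg _))
    _ ≤ C' * (2 ^ n * (C * √n)) := by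
        rw [← Finset.mul_sum]
        exact mul_le_mul_of_nonneg_left (sum_norm_sign_le x C hC hx) hC'
    _ = _ := by ring

theorem sum_abs_signSum_one_le (n : ℕ) :
    ∑ ε : Fin n → ℤˣ, |signSum ε fun _ => 1| ≤ 2 ^ n * √n := by
  have := sum_norm_sign_le (fun _ : Fin n => (1 : ℝ)) 1 zero_le_one (by simp)
  simpa [signSum] using this

end Rademacher

/-! ### McDiarmid's inequality, symmetrization and uniform deviation. -/

section Concentration

open ProbabilityTheory

variable {Z : Type*} [MeasurableSpace Z]

theorem abs_iSup_le {ι : Type*} [Finite ι] [Nonempty ι] (f : ι → ℝ) (K : ℝ)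
    (h : ∀ i, |f i| ≤ K) : |⨆ i, f i| ≤ K := by
  obtain ⟨i, hi⟩ := exists_eq_ciSup_of_finite (f := f)
  exact hi ▸ h i

theorem integrable_of_abs_le {μ : Measure Z} [IsFiniteMeasure μ] {f : Z → ℝ} (hf : Measurable f)
    (K : ℝ) (hK : ∀ z, |f z| ≤ K) : Integrable f μ :=
  Integrable.of_bound hf.aestronglyMeasurable K (Filter.Eventually.of_forall hK)

/-- **McDiarmid's inequality**, in the form of a sub-Gaussian bound. -/
theorem hasSubgaussianMGF_of_update_sub_le (Q : Measure Z) [IsProbabilityMeasure Q] (c K : ℝ)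
    {n : ℕ} (F : (Fin n → Z) → ℝ) (hF : Measurable F) (hK : ∀ s, |F s| ≤ K)
    (hc : ∀ s j z, F (Function.update s j z) - F s ≤ c) :
    HasSubgaussianMGF (fun s => F s - ∫ s, F s ∂(Measure.pi fun _ => Q))
      (n * (‖c‖₊ / 2) ^ 2) (Measure.pi fun _ => Q) := by
  induction n with
  | zero =>
    have : ∀ s, F s = F (fun i => i.elim0) := fun s => congrArg F (Subsingleton.elim _ _)
    simp only [CharP.cast_eq_zero, zero_mul]
    simp [this]
  | succ n ih =>
    have : Nonempty Z := Q.nonempty_of_neZero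
    set P : Measure (Fin n → Z) := Measure.pi fun _ => Q with hP
    set e := MeasurableEquiv.piFinSuccAbove (fun _ : Fin (n + 1) => Z) 0 with he
    have hmp : MeasurePreserving e (Measure.pi fun _ => Q) (Q.prod P) :=
      measurePreserving_piFinSuccAbove (fun _ : Fin (n + 1) => Q) 0
    set H : Z × (Fin n → Z) → ℝ := fun p => F (e.symm p) with hH
    have hHm : Measurable H := hF.comp e.symm.measurable
    have hHK : ∀ p, |H p| ≤ K := fun p => hK _
    have hHi : Integrable H (Q.prod P) := integrable_of_abs_le hHm K hHK
    have hHz : ∀ z, Measurable fun s => H (z, s) := fun z =>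
      hHm.comp measurable_prodMk_left
    -- `g` is the conditional expectation given the first coordinate. In `F - E F = (H - g) + (g - E
    -- g)` the first summand is sub-Gaussian for each fixed `z` by induction, and the second by
    -- Hoeffding's lemma, since `g` ranges over an interval of length `c`. The variance proxies add.
    set g : Z → ℝ := fun z => ∫ s, H (z, s) ∂P with hg
    have hgm : Measurable g :=
      (hHm.stronglyMeasurable.integral_prod_right').measurable
    have hHcons : ∀ z s, H (z, s) = F (Fin.cons z s) := fun z s => by
      simp [hH, he, MeasurableEquiv.piFinSuccAbove, Fin.insertNthEquiv]
    have hgK : ∀ z, |g z| ≤ K := fun z => by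
      have := norm_integral_le_of_norm_le_const (μ := P) (f := fun s => H (z, s)) (C := K)
        (Filter.Eventually.of_forall fun s => hHK _)
      simpa using this
    have hgc : ∀ z z', g z - g z' ≤ c := by
      intro z z'
      rw [hg]
      simp only
      rw [← integral_sub (integrable_of_abs_le (hHz z) K fun _ => hHK _)
        (integrable_of_abs_le (hHz z') K fun _ => hHK _)]
      have h1 : ∫ s, (H (z, s) - H (z', s)) ∂P ≤ ∫ _s, c ∂P := by
        refine integral_mono ((integrable_of_abs_le (hHz z) K fun _ => hHK _).sub
          (integrable_of_abs_le (hHz z') K fun _ => hHK _)) (integrable_const _) fun s => ?_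
        have := hc (Fin.cons z' s) 0 z
        rw [Fin.update_cons_zero] at this
        simpa [hHcons] using this
      simpa using h1
    have hint : ∫ s, F s ∂(Measure.pi fun _ => Q) = ∫ z, g z ∂Q := by
      rw [← integral_prod H hHi, ← hmp.integral_comp e.measurableEmbedding]
      simp [hH]
    have hbdd : BddBelow (Set.range g) :=
      ⟨-K, by rintro _ ⟨z, rfl⟩; exact (abs_le.1 (hgK z)).1⟩
    have hsub : HasSubgaussianMGF (fun z => g z - ∫ z, g z ∂Q) ((‖c‖₊ / 2) ^ 2) Q := by
      have := hasSubgaussianMGF_of_mem_Icc (μ := Q) (X := g) (a := ⨅ z, g z)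
        (b := (⨅ z, g z) + c) hgm.aemeasurable
        (Filter.Eventually.of_forall fun z => ⟨ciInf_le hbdd z, by
          have : g z - c ≤ ⨅ z, g z := le_ciInf fun z' => by linarith [hgc z z']
          linarith⟩)
      simpa using this
    have hin : ∀ z, HasSubgaussianMGF (fun s => H (z, s) - g z) (n * (‖c‖₊ / 2) ^ 2) P := by
      intro z
      refine ih (fun s => H (z, s)) (hHz z) (fun s => hHK _) fun s j z' => ?_
      have := hc (Fin.cons z s) j.succ z'
      rw [← Fin.cons_update] at this
      simpa only [hHcons] using this
    have hprod : HasSubgaussianMGF (fun p => H p - ∫ z, g z ∂Q)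
        ((n + 1 : ℕ) * (‖c‖₊ / 2) ^ 2) (Q.prod P) := by
      have hei : ∀ t : ℝ, Integrable (fun p => Real.exp (t * (H p - ∫ z, g z ∂Q)))
          (Q.prod P) := by
        intro t
        refine integrable_of_abs_le (by fun_prop)
          (Real.exp (|t| * (K + |∫ z, g z ∂Q|))) fun p => ?_
        rw [Real.abs_exp, Real.exp_le_exp]
        refine (le_abs_self _).trans ?_
        rw [abs_mul]
        exact mul_le_mul_of_nonneg_left
          ((abs_sub _ _).trans (add_le_add_left (hHK p) _)) (abs_nonneg t)
      refine ⟨hei, fun t => ?_⟩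
      rw [mgf, integral_prod _ (hei t)]
      have hstep : ∀ z, ∫ s, Real.exp (t * (H (z, s) - ∫ z, g z ∂Q)) ∂P ≤
          Real.exp ((n * (‖c‖₊ / 2) ^ 2 : NNReal) * t ^ 2 / 2) *
            Real.exp (t * (g z - ∫ z, g z ∂Q)) := by
        intro z
        have h1 := (hin z).mgf_le t
        rw [mgf] at h1
        calc _ = ∫ s, Real.exp (t * (H (z, s) - g z)) *
              Real.exp (t * (g z - ∫ z, g z ∂Q)) ∂P := by
              refine integral_congr_ae (Filter.Eventually.of_forall fun s => ?_)
              simp only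
              rw [← Real.exp_add]
              congr 1
              ring
          _ ≤ _ := by
              rw [integral_mul_const]
              exact mul_le_mul_of_nonneg_right h1 (Real.exp_nonneg _)
      refine (integral_mono (hei t).integral_prod_left
        ((hsub.integrable_exp_mul t).const_mul _) hstep).trans ?_
      rw [integral_const_mul]
      refine (mul_le_mul_of_nonneg_left (hsub.mgf_le t) (Real.exp_nonneg _)).trans ?_
      rw [← Real.exp_add]
      refine le_of_eq (congrArg _ ?_)
      push_cast
      ring
    rw [hint]
    rw [← hmp.map_eq] at hprod
    have := HasSubgaussianMGF.of_map hmp.measurable.aemeasurable hprod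
    simpa [hH, Function.comp_def] using this

/-- Symmetrization: the expected supremum of the centered empirical process is at most twice
the Rademacher complexity. -/
theorem integral_iSup_le_rademacher (Q : Measure Z) [IsProbabilityMeasure Q] {ι : Type*}
    [Finite ι] [Nonempty ι] {n : ℕ} (g : ι → Z → ℝ) (hg : ∀ i, Measurable (g i)) (K R : ℝ)
    (hK : ∀ i z, |g i z| ≤ K)
    (hR : ∀ᵐ S ∂(Measure.pi fun _ : Fin n => Q),
      ∑ ε : Fin n → ℤˣ, ⨆ i, signSum ε (fun j => g i (S j)) ≤ 2 ^ n * R) :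
    ∫ S, ⨆ i, ∑ j, (∫ z, g i z ∂Q - g i (S j)) ∂(Measure.pi fun _ : Fin n => Q) ≤ 2 * R := by
  set P : Measure (Fin n → Z) := Measure.pi fun _ => Q with hP
  set P2 : Measure (Fin n → Z × Z) := Measure.pi fun _ => Q.prod Q with hP2
  have hKsum : ∀ (i) (ε : Fin n → ℤˣ) (S S' : Fin n → Z),
      |signSum ε fun j => g i (S' j) - g i (S j)| ≤ n * (2 * K) := by
    intro i ε S S'
    calc _ ≤ ∑ j : Fin n, 2 * K := by
          refine (Finset.abs_sum_le_sum_abs _ _).trans (Finset.sum_le_sum fun j _ => ?_)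
          rw [abs_mul, ← Int.cast_abs, Int.isUnit_iff_abs_eq.1 (ε j).isUnit, Int.cast_one,
            one_mul]
          exact (abs_sub _ _).trans (by linarith [hK i (S' j), hK i (S j)])
      _ = _ := by simp
  have hmeas : ∀ ε : Fin n → ℤˣ, Measurable fun p : (Fin n → Z) × (Fin n → Z) =>
      ⨆ i, signSum ε fun j => g i (p.2 j) - g i (p.1 j) := by
    intro ε
    refine Measurable.iSup fun i => ?_
    unfold signSum
    have := hg i
    fun_prop
  set H : (Fin n → ℤˣ) → (Fin n → Z × Z) → ℝ := fun ε T =>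
    ⨆ i, signSum ε fun j => g i (T j).2 - g i (T j).1 with hH
  have hHm : ∀ ε, Measurable (H ε) := fun ε => by
    have := (hmeas ε).comp (MeasurableEquiv.arrowProdEquivProdArrow Z Z (Fin n)).measurable
    exact this
  have hHi : ∀ ε, Integrable (H ε) P2 := fun ε =>
    integrable_of_abs_le (hHm ε) (n * (2 * K)) fun T => abs_iSup_le _ _ fun i => hKsum i ε _ _
  have hfst : MeasurePreserving (fun (T : Fin n → Z × Z) j => (T j).1) P2 P :=
    measurePreserving_pi _ _ fun _ => measurePreserving_fst
  have hsnd : MeasurePreserving (fun (T : Fin n → Z × Z) j => (T j).2) P2 P :=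
    measurePreserving_pi _ _ fun _ => measurePreserving_snd
  have hcoord : ∀ i j, ∫ S, g i (S j) ∂P = ∫ z, g i z ∂Q := fun i j =>
    integral_comp_eval (μ := fun _ : Fin n => Q) (hg i).aestronglyMeasurable
  have hginti : ∀ i j, Integrable (fun S : Fin n → Z => g i (S j)) P := fun i j =>
    integrable_of_abs_le ((hg i).comp (measurable_pi_apply j)) K fun S => hK i _
  have hprodi : Integrable (fun p : (Fin n → Z) × (Fin n → Z) =>
      ⨆ i, signSum (1 : Fin n → ℤˣ) fun j => g i (p.2 j) - g i (p.1 j)) (P.prod P) :=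
    integrable_of_abs_le (hmeas 1) (n * (2 * K)) fun p => abs_iSup_le _ _ fun i => hKsum i 1 _ _
  -- Each mean is an average over an independent ghost sample `S'`, and a supremum of averages is at
  -- most the average of the suprema.
  have hghost : ∀ S : Fin n → Z, ⨆ i, ∑ j, (∫ z, g i z ∂Q - g i (S j)) ≤
      ∫ S', ⨆ i, signSum (1 : Fin n → ℤˣ) (fun j => g i (S' j) - g i (S j)) ∂P := by
    intro S
    refine ciSup_le fun i => ?_
    calc _ = ∫ S', signSum (1 : Fin n → ℤˣ) (fun j => g i (S' j) - g i (S j)) ∂P := by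
          simp only [signSum, Pi.one_apply, Units.val_one, Int.cast_one, one_mul]
          rw [integral_finsetSum _ fun j _ => (hginti i j).sub' (integrable_const (g i (S j)))]
          refine Finset.sum_congr rfl fun j _ => ?_
          rw [integral_sub (hginti i j) (integrable_const _), hcoord]
          simp
      _ ≤ _ := by
          refine integral_mono ?_ ?_ fun S' =>
            le_iSup_of_finite (fun i => signSum 1 fun j => g i (S' j) - g i (S j)) i
          · refine integrable_of_abs_le ?_ (n * (2 * K)) fun S' => hKsum i 1 _ _
            unfold signSum
            have := hg i
            fun_prop
          · have := (hmeas 1).comp (measurable_prodMk_left (x := S))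
            exact integrable_of_abs_le this (n * (2 * K))
              fun S' => abs_iSup_le _ _ fun i => hKsum i 1 _ _
  have hleft : ∫ S, ⨆ i, ∑ j, (∫ z, g i z ∂Q - g i (S j)) ∂P ≤ ∫ T, H 1 T ∂P2 := by
    have hmp := measurePreserving_arrowProdEquivProdArrow Z Z (Fin n) (fun _ => Q) (fun _ => Q)
    have : ∫ T, H 1 T ∂P2 = ∫ p, (⨆ i, signSum (1 : Fin n → ℤˣ)
        fun j => g i (p.2 j) - g i (p.1 j)) ∂(P.prod P) := by
      rw [hP, ← hmp.integral_comp (MeasurableEquiv.measurableEmbedding _)]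
      rfl
    rw [this, integral_prod _ hprodi]
    refine integral_mono ?_ hprodi.integral_prod_left hghost
    refine integrable_of_abs_le (Measurable.iSup fun i => ?_) (n * (2 * K)) fun S =>
      abs_iSup_le _ _ fun i => ?_
    · have := hg i
      fun_prop
    · have hgi : |∫ z, g i z ∂Q| ≤ K := by
        have := norm_integral_le_of_norm_le_const (μ := Q) (f := g i) (C := K)
          (Filter.Eventually.of_forall fun s => hK i s)
        simpa using this
      calc _ ≤ ∑ j : Fin n, 2 * K := by
            refine (Finset.abs_sum_le_sum_abs _ _).trans (Finset.sum_le_sum fun j _ => ?_)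
            exact (abs_sub _ _).trans (by linarith [hK i (S j)])
        _ = _ := by simp
  -- Flipping the sign at `j` amounts to exchanging the two members of the `j`-th pair, which
  -- preserves the law. Hence `H 1` may be averaged over all signs.
  have hswap : ∀ ε : Fin n → ℤˣ, ∫ T, H ε T ∂P2 = ∫ T, H 1 T ∂P2 := by
    intro ε
    have hmp : MeasurePreserving
        (fun (T : Fin n → Z × Z) j => (if ε j = 1 then id else Prod.swap) (T j)) P2 P2 := by
      refine measurePreserving_pi _ _ fun j => ?_
      split_ifs
      · exact MeasurePreserving.id _
      · exact Measure.measurePreserving_swap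
    have h1 : ∀ T, H ε T =
        H 1 (fun j => (if ε j = 1 then id else Prod.swap) (T j)) := by
      intro T
      simp only [hH, signSum]
      congr 1
      ext i
      refine Finset.sum_congr rfl fun j _ => ?_
      rcases Int.units_eq_one_or (ε j) with h | h <;> simp [h]
    rw [integral_congr_ae (Filter.Eventually.of_forall h1),
      ← integral_map hmp.measurable.aemeasurable (hHm 1).aestronglyMeasurable, hmp.map_eq]
  have hsum : 2 ^ n * ∫ T, H 1 T ∂P2 = ∫ T, ∑ ε, H ε T ∂P2 := by
    rw [integral_finsetSum _ fun ε _ => hHi ε, Finset.sum_congr rfl fun ε _ => hswap ε]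
    simp
  have hbound : ∫ T, ∑ ε, H ε T ∂P2 ≤ ∫ _T, 2 ^ n * (2 * R) ∂P2 := by
    refine integral_mono_ae (integrable_finsetSum _ fun ε _ => hHi ε) (integrable_const _) ?_
    filter_upwards [hfst.quasiMeasurePreserving.ae hR, hsnd.quasiMeasurePreserving.ae hR]
      with T h1 h2
    calc ∑ ε, H ε T ≤ ∑ ε : Fin n → ℤˣ, ((⨆ i, signSum ε (fun j => g i (T j).2)) +
          ⨆ i, signSum (-ε) (fun j => g i (T j).1)) := by
          refine Finset.sum_le_sum fun ε _ => ciSup_le fun i => ?_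
          have h3 := le_iSup_of_finite (fun i => signSum ε (fun j => g i (T j).2)) i
          have h4 := le_iSup_of_finite (fun i => signSum (-ε) (fun j => g i (T j).1)) i
          refine le_trans (le_of_eq ?_) (add_le_add h3 h4)
          rw [signSum_neg, ← sub_eq_add_neg]
          simp [signSum, mul_sub]
      _ ≤ _ := by
          rw [Finset.sum_add_distrib,
            sum_sign_neg (fun ε => ⨆ i, signSum ε (fun j => g i (T j).1))]
          linarith
  refine hleft.trans ?_
  rw [← hsum] at hbound
  simp only [integral_const, probReal_univ, one_smul] at hbound
  exact le_of_mul_le_mul_left hbound (by positivity)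

/-- Uniform deviation bound for a finite class of functions with values in `[0, c]`, relative to
a fixed reference function. -/
theorem measure_uniform_deviation_le (Q : Measure Z) [IsProbabilityMeasure Q] {ι : Type*}
    [Finite ι] [Nonempty ι] {n : ℕ} (hn : 1 ≤ n) (g : ι → Z → ℝ) (hg : ∀ i, Measurable (g i))
    (g₀ : Z → ℝ) (hg₀ : Measurable g₀) (c R δ : ℝ) (hc : 0 < c)
    (hgc : ∀ i z, g i z ∈ Set.Icc 0 c) (hg₀c : ∀ z, g₀ z ∈ Set.Icc 0 c)
    (hR : ∀ᵐ S ∂(Measure.pi fun _ : Fin n => Q),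
      ∑ ε : Fin n → ℤˣ, ⨆ i, signSum ε (fun j => g i (S j)) ≤ 2 ^ n * R)
    (hδ0 : 0 < δ) (hδ1 : δ < 1) :
    Measure.pi (fun _ : Fin n => Q) {S | ∃ i, 2 * R + c * √(2 * n * Real.log (1 / δ)) <
      ∑ j, (∫ z, g i z ∂Q - g i (S j)) - ∑ j, (∫ z, g₀ z ∂Q - g₀ (S j))} ≤
      ENNReal.ofReal δ := by
  set P : Measure (Fin n → Z) := Measure.pi fun _ => Q with hP
  have habs : ∀ i z, |g i z| ≤ c := fun i z => abs_le.2 ⟨by linarith [(hgc i z).1], (hgc i z).2⟩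
  have habs₀ : ∀ z, |g₀ z| ≤ c := fun z => abs_le.2 ⟨by linarith [(hg₀c z).1], (hg₀c z).2⟩
  have hcent : ∀ h : Z → ℝ, (∀ z, |h z| ≤ c) → ∀ S : Fin n → Z,
      |∑ j, (∫ z, h z ∂Q - h (S j))| ≤ n * (2 * c) := by
    intro h hh S
    have hi : |∫ z, h z ∂Q| ≤ c := by
      have := norm_integral_le_of_norm_le_const (μ := Q) (f := h) (C := c)
        (Filter.Eventually.of_forall fun s => hh s)
      simpa using this
    calc _ ≤ ∑ j : Fin n, 2 * c := by
          refine (Finset.abs_sum_le_sum_abs _ _).trans (Finset.sum_le_sum fun j _ => ?_)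
          exact (abs_sub _ _).trans (by linarith [hh (S j)])
      _ = _ := by simp
  set U : (Fin n → Z) → ℝ := fun S => ⨆ i, ∑ j, (∫ z, g i z ∂Q - g i (S j)) with hU
  set V : (Fin n → Z) → ℝ := fun S => ∑ j, (∫ z, g₀ z ∂Q - g₀ (S j)) with hV
  have hUm : Measurable U := Measurable.iSup fun i => by
    have := hg i
    fun_prop
  have hVm : Measurable V := by fun_prop
  have hUK : ∀ S, |U S| ≤ n * (2 * c) := fun S => abs_iSup_le _ _ fun i => hcent _ (habs i) S
  have hVK : ∀ S, |V S| ≤ n * (2 * c) := fun S => hcent _ habs₀ S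
  have hUi : Integrable U P := integrable_of_abs_le hUm _ hUK
  have hVi : Integrable V P := integrable_of_abs_le hVm _ hVK
  have hV0 : ∫ S, V S ∂P = 0 := by
    have hgi : ∀ j, Integrable (fun S : Fin n → Z => g₀ (S j)) P := fun j =>
      integrable_of_abs_le (hg₀.comp (measurable_pi_apply j)) c fun S => habs₀ _
    simp only [hV]
    rw [integral_finsetSum _ fun j _ => (integrable_const (∫ z, g₀ z ∂Q)).sub' (hgi j)]
    refine Finset.sum_eq_zero fun j _ => ?_
    rw [integral_sub (integrable_const _) (hgi j),
      integral_comp_eval (μ := fun _ : Fin n => Q) hg₀.aestronglyMeasurable]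
    simp
  have hE : ∫ S, (U S - V S) ∂P ≤ 2 * R := by
    rw [integral_sub hUi hVi, hV0, sub_zero]
    exact integral_iSup_le_rademacher Q g hg c R habs hR
  have hupd : ∀ (h : Z → ℝ) (r : ℝ) (S : Fin n → Z) (j : Fin n) (z : Z),
      ∑ k, (r - h (Function.update S j z k)) = ∑ k, (r - h (S k)) + (h (S j) - h z) := by
    intro h r S j z
    rw [← Finset.add_sum_erase _ _ (Finset.mem_univ j),
      ← Finset.add_sum_erase _ (fun k => r - h (S k)) (Finset.mem_univ j)]
    have : ∀ k ∈ Finset.univ.erase j, r - h (Function.update S j z k) = r - h (S k) := by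
      intro k hk
      rw [Function.update_of_ne (Finset.ne_of_mem_erase hk)]
    rw [Finset.sum_congr rfl this, Function.update_self]
    ring
  -- Replacing one observation raises `U` by at most `c` and lowers `V` by at most `c`.
  have hbd : ∀ S j z, (U (Function.update S j z) - V (Function.update S j z)) - (U S - V S) ≤
      2 * c := by
    intro S j z
    have h1 : U (Function.update S j z) ≤ U S + c := by
      refine ciSup_le fun i => ?_
      rw [hupd]
      have h2 := le_iSup_of_finite (fun i => ∑ j, (∫ z, g i z ∂Q - g i (S j))) i
      exact add_le_add h2 (by linarith [(hgc i (S j)).2, (hgc i z).1])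
    have h3 : V (Function.update S j z) = V S + (g₀ (S j) - g₀ z) := hupd _ _ _ _ _
    linarith [(hg₀c z).2, (hg₀c (S j)).1]
  have hsub := hasSubgaussianMGF_of_update_sub_le Q (2 * c) (n * (2 * c) + n * (2 * c))
    (fun S => U S - V S) (hUm.sub hVm)
    (fun S => (abs_sub _ _).trans (add_le_add (hUK S) (hVK S))) hbd
  have hlog : 0 < Real.log (1 / δ) := Real.log_pos ((one_lt_div hδ0).2 hδ1)
  have hn0 : (0 : ℝ) < n := by exact_mod_cast hn
  have htail := hsub.measure_ge_le (ε := c * √(2 * n * Real.log (1 / δ))) (by positivity)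
  -- With differences `2 * c` the variance proxy is `n * c ^ 2`, and the threshold is chosen to make
  -- the tail exactly `δ`.
  have hexp : Real.exp (-(c * √(2 * n * Real.log (1 / δ))) ^ 2 /
      (2 * ((n * (‖2 * c‖₊ / 2) ^ 2 : NNReal) : ℝ))) = δ := by
    have h1 : (((n * (‖2 * c‖₊ / 2) ^ 2 : NNReal) : ℝ)) = n * c ^ 2 := by
      push_cast
      rw [Real.norm_of_nonneg (by positivity)]
      ring
    rw [h1, mul_pow, Real.sq_sqrt (by positivity)]
    have h2 : -(c ^ 2 * (2 * n * Real.log (1 / δ))) / (2 * (n * c ^ 2)) = -Real.log (1 / δ) := by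
      field_simp
    rw [h2, Real.log_div one_ne_zero hδ0.ne', Real.log_one, zero_sub, neg_neg, Real.exp_log hδ0]
  rw [hexp] at htail
  rw [← ENNReal.ofReal_toReal (measure_ne_top P _)]
  refine ENNReal.ofReal_le_ofReal (le_trans ?_ htail)
  refine measureReal_mono fun S hS => ?_
  obtain ⟨i, hi⟩ := hS
  have h2 := le_iSup_of_finite (fun i => ∑ j, (∫ z, g i z ∂Q - g i (S j))) i
  change c * √(2 * n * Real.log (1 / δ)) ≤ U S - V S - ∫ S, (U S - V S) ∂P
  have h3 : ∑ j, (∫ z, g i z ∂Q - g i (S j)) ≤ U S := h2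
  have h4 : V S = ∑ j, (∫ z, g₀ z ∂Q - g₀ (S j)) := rfl
  linarith

/-- The same bound for a countable class, by continuity of the measure along its finite
subclasses. -/
theorem measure_uniform_deviation_le_of_countable (Q : Measure Z) [IsProbabilityMeasure Q]
    {n : ℕ} (hn : 1 ≤ n) (g : ℕ → Z → ℝ) (hg : ∀ i, Measurable (g i))
    (g₀ : Z → ℝ) (hg₀ : Measurable g₀) (c R δ : ℝ) (hc : 0 < c)
    (hgc : ∀ i z, g i z ∈ Set.Icc 0 c) (hg₀c : ∀ z, g₀ z ∈ Set.Icc 0 c)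
    (hR : ∀ k : ℕ, ∀ᵐ S ∂(Measure.pi fun _ : Fin n => Q),
      ∑ ε : Fin n → ℤˣ, ⨆ i : Fin (k + 1), signSum ε (fun j => g i (S j)) ≤ 2 ^ n * R)
    (hδ0 : 0 < δ) (hδ1 : δ < 1) :
    Measure.pi (fun _ : Fin n => Q) {S | ∃ i, 2 * R + c * √(2 * n * Real.log (1 / δ)) <
      ∑ j, (∫ z, g i z ∂Q - g i (S j)) - ∑ j, (∫ z, g₀ z ∂Q - g₀ (S j))} ≤
      ENNReal.ofReal δ := by
  set B : ℕ → Set (Fin n → Z) := fun k => {S | ∃ i : Fin (k + 1),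
    2 * R + c * √(2 * n * Real.log (1 / δ)) <
      ∑ j, (∫ z, g i z ∂Q - g i (S j)) - ∑ j, (∫ z, g₀ z ∂Q - g₀ (S j))} with hB
  have hmono : Monotone B := fun k l hkl S ⟨i, hi⟩ => ⟨Fin.castLE (by omega) i, by simpa using hi⟩
  have hunion : {S | ∃ i, 2 * R + c * √(2 * n * Real.log (1 / δ)) <
      ∑ j, (∫ z, g i z ∂Q - g i (S j)) - ∑ j, (∫ z, g₀ z ∂Q - g₀ (S j))} ⊆ ⋃ k, B k := by
    rintro S ⟨i, hi⟩
    exact Set.mem_iUnion.2 ⟨i, ⟨i, by omega⟩, hi⟩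
  refine (measure_mono hunion).trans ?_
  rw [hmono.measure_iUnion]
  exact iSup_le fun k => measure_uniform_deviation_le Q hn (fun i : Fin (k + 1) => g i)
    (fun i => hg i) g₀ hg₀ c R δ hc (fun i => hgc i) hg₀c (hR k) hδ0 hδ1

end Concentration

/-! ### Logistic loss, output bound and complexity of networks. -/

section Network

theorem one_add_exp_pos (t : ℝ) : 0 < 1 + Real.exp t := by positivity

theorem logisticLoss_mem_Icc {B t y : ℝ} (hy : y = -1 ∨ y = 1) (ht : |t| ≤ B) :
    logisticLoss t y ∈ Set.Icc 0 (Real.log (1 + Real.exp B)) := by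
  have h := abs_le.1 ht
  refine ⟨Real.log_nonneg (by linarith [Real.exp_pos (-(y * t))]),
    Real.log_le_log (one_add_exp_pos _) ?_⟩
  have : -(y * t) ≤ B := by rcases hy with rfl | rfl <;> linarith
  gcongr

/-- The derivative is the increasing sigmoid, so on `(-∞, B]` it is at most its value at `B`, which
is `(1 + exp (-B))⁻¹`. -/
theorem abs_log_one_add_exp_sub_le {B s t : ℝ} (hs : s ≤ B) (ht : t ≤ B) :
    |Real.log (1 + Real.exp s) - Real.log (1 + Real.exp t)| ≤
      (1 + Real.exp (-B))⁻¹ * |s - t| := by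
  have hd : ∀ u ∈ Set.Iic B, HasDerivWithinAt (fun u => Real.log (1 + Real.exp u))
      (Real.exp u / (1 + Real.exp u)) (Set.Iic B) u := fun u _ =>
    (((Real.hasDerivAt_exp u).const_add 1).log (one_add_exp_pos u).ne').hasDerivWithinAt
  refine (convex_Iic B).norm_image_sub_le_of_norm_hasDerivWithin_le hd (fun u hu => ?_) ht hs
  rw [Real.norm_of_nonneg (by positivity), div_le_iff₀ (one_add_exp_pos u),
    inv_mul_eq_div, le_div_iff₀ (one_add_exp_pos _)]
  have : Real.exp u * Real.exp (-B) ≤ 1 := by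
    rw [← Real.exp_add, Real.exp_le_one_iff]
    linarith [Set.mem_Iic.1 hu]
  linarith

theorem abs_logisticLoss_sub_le {B s t y : ℝ} (hy : y = -1 ∨ y = 1) (hs : |s| ≤ B)
    (ht : |t| ≤ B) :
    |logisticLoss s y - logisticLoss t y| ≤ (1 + Real.exp (-B))⁻¹ * |s - t| := by
  have hs := abs_le.1 hs
  have ht := abs_le.1 ht
  have h1 : -(y * s) ≤ B := by rcases hy with rfl | rfl <;> linarith
  have h2 : -(y * t) ≤ B := by rcases hy with rfl | rfl <;> linarith
  refine (abs_log_one_add_exp_sub_le h1 h2).trans (le_of_eq ?_)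
  congr 1
  rcases hy with rfl | rfl
  · congr 1
    ring
  · rw [abs_sub_comm]
    congr 1
    ring

variable {D M : ℕ}

/-- The variance identity that turns a lower bound on diversity into an upper bound on `(∑ m, φ m) ^
2`. -/
theorem sum_offDiag_sub_sq (φ : Fin M → ℝ) :
    ∑ p ∈ (Finset.univ : Finset (Fin M)).offDiag, (φ p.1 - φ p.2) ^ 2 =
      2 * (M * ∑ m, φ m ^ 2 - (∑ m, φ m) ^ 2) := by
  have h1 : ∑ p ∈ (Finset.univ : Finset (Fin M)).offDiag, (φ p.1 - φ p.2) ^ 2 =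
      ∑ p : Fin M × Fin M, (φ p.1 - φ p.2) ^ 2 := by
    refine Finset.sum_subset (Finset.subset_univ _) fun p _ hp => ?_
    have : p.1 = p.2 := by simpa using hp
    simp [this]
  rw [h1, Fintype.sum_prod_type]
  have h2 : ∀ m n : Fin M, (φ m - φ n) ^ 2 = φ m ^ 2 + φ n ^ 2 - 2 * (φ m * φ n) :=
    fun m n => by ring
  simp only [h2, Finset.sum_sub_distrib, Finset.sum_add_distrib, ← Finset.mul_sum,
    Finset.sum_const, Finset.card_univ, Fintype.card_fin, nsmul_eq_mul]
  rw [← Finset.sum_mul]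
  ring

theorem feature_le {ρ : ℝ → ℝ} {L : NNReal} (hρ : LipschitzWith L ρ) {C₁ C₃ : ℝ}
    {W : Fin M → Input D} (hW : ∀ m, ‖W m‖ ≤ C₃) {x : Input D} (hx : ‖x‖ ≤ C₁) (m : Fin M) :
    feature ρ W m x ≤ constC₅ ρ L C₁ C₃ := by
  have h1 := (le_abs_self _).trans (hρ.dist_le_mul (inner ℝ (W m) x) 0)
  have h2 : |inner ℝ (W m) x| ≤ C₁ * C₃ := by
    refine (abs_real_inner_le_norm _ _).trans ?_
    rw [mul_comm]
    exact mul_le_mul hx (hW m) (norm_nonneg _) ((norm_nonneg x).trans hx)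
  rw [Real.dist_eq, sub_zero] at h1
  have h4 := mul_le_mul_of_nonneg_left h2 L.coe_nonneg
  unfold feature constC₅
  linarith

/-- The diversity constraint bounds the outputs of the network. -/
theorem abs_network_le (hM : 2 ≤ M) {ρ : ℝ → ℝ} (hρ0 : ∀ t, 0 ≤ ρ t) {L : NNReal}
    (hρ : LipschitzWith L ρ) {C₁ C₃ C₄ d : ℝ} {W : Fin M → Input D} {v : Fin M → ℝ}
    (hW : ∀ m, ‖W m‖ ≤ C₃) (hv : ‖v‖ ≤ C₄) {x : Input D} (hx : ‖x‖ ≤ C₁)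
    (hd : d ^ 2 ≤ diversity ρ W x) :
    |network ρ W v x| ≤ √(constJ M ρ L C₁ C₃ C₄ d) := by
  have hM' : (2 : ℝ) ≤ M := by exact_mod_cast hM
  have hC₄ : 0 ≤ C₄ := (norm_nonneg v).trans hv
  have hφ0 : ∀ m, 0 ≤ feature ρ W m x := fun m => hρ0 _
  have hφ : ∀ m, feature ρ W m x ≤ constC₅ ρ L C₁ C₃ := feature_le hρ hW hx
  have h1 : |network ρ W v x| ≤ C₄ * ∑ m, feature ρ W m x := by
    rw [Finset.mul_sum]
    refine (Finset.abs_sum_le_sum_abs _ _).trans (Finset.sum_le_sum fun m _ => ?_)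
    rw [abs_mul, abs_of_nonneg (hφ0 m)]
    exact mul_le_mul_of_nonneg_right ((norm_le_pi_norm v m).trans hv) (hφ0 m)
  have h2 : ∑ m, feature ρ W m x ^ 2 ≤ M * constC₅ ρ L C₁ C₃ ^ 2 := by
    calc _ ≤ ∑ _m : Fin M, constC₅ ρ L C₁ C₃ ^ 2 :=
          Finset.sum_le_sum fun m _ => pow_le_pow_left₀ (hφ0 m) (hφ m) 2
      _ = _ := by simp
  have h3 : d ^ 2 * ((M : ℝ) * (M - 1)) ≤
      M * ∑ m, feature ρ W m x ^ 2 - (∑ m, feature ρ W m x) ^ 2 := by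
    rw [diversity, sum_offDiag_sub_sq (fun m => feature ρ W m x), one_div, inv_mul_eq_div,
      le_div_iff₀ (by nlinarith)] at hd
    linarith
  refine Real.le_sqrt_of_sq_le ?_
  calc |network ρ W v x| ^ 2 ≤ (C₄ * ∑ m, feature ρ W m x) ^ 2 :=
        pow_le_pow_left₀ (abs_nonneg _) h1 2
    _ = C₄ ^ 2 * (∑ m, feature ρ W m x) ^ 2 := mul_pow _ _ _
    _ ≤ _ := by
        refine mul_le_mul_of_nonneg_left ?_ (sq_nonneg _)
        have h4 := mul_le_mul_of_nonneg_left h2 (by linarith : (0 : ℝ) ≤ M)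
        linarith

/-- Rademacher complexity of a finite class of networks. -/
theorem sum_iSup_signSum_network_le {ρ : ℝ → ℝ} {L : NNReal} (hρ : LipschitzWith L ρ)
    {C₁ C₃ C₄ : ℝ} (hC₁ : 0 ≤ C₁) (hC₃ : 0 ≤ C₃) (hC₄ : 0 ≤ C₄) {ι : Type*} [Finite ι]
    [Nonempty ι] (W : ι → Fin M → Input D) (v : ι → Fin M → ℝ) (hW : ∀ i m, ‖W i m‖ ≤ C₃)
    (hv : ∀ i, ‖v i‖ ≤ C₄) {n : ℕ} (x : Fin n → Input D) (hx : ∀ j, ‖x j‖ ≤ C₁) :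
    ∑ ε : Fin n → ℤˣ, ⨆ i, signSum ε (fun j => network ρ (W i) (v i) (x j)) ≤
      2 ^ n * (M * C₄ * ((|ρ 0| + 2 * L * (C₁ * C₃)) * √n)) := by
  -- The extra index `none` carries the zero weight, where `ρ (inner ..) - ρ 0` vanishes; this is
  -- the zero member that `sum_iSup_abs_signSum_le` needs. The constant `ρ 0` is split off and
  -- estimated separately.
  set w : Option (ι × Fin M) → Input D := fun o => o.elim 0 fun p => W p.1 p.2 with hw
  have hwn : ∀ o, ‖w o‖ ≤ C₃ := by
    rintro (_ | ⟨i, m⟩)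
    · simpa [hw] using hC₃
    · exact hW i m
  set h : Option (ι × Fin M) → Fin n → ℝ := fun o j => ρ (inner ℝ (w o) (x j)) - ρ 0 with hh
  have hpt : ∀ ε : Fin n → ℤˣ, ⨆ i, signSum ε (fun j => network ρ (W i) (v i) (x j)) ≤
      M * C₄ * (|ρ 0| * |signSum ε fun _ => 1| + ⨆ o, |signSum ε (h o)|) := by
    intro ε
    refine ciSup_le fun i => ?_
    have h1 : signSum ε (fun j => network ρ (W i) (v i) (x j)) =
        ∑ m, v i m * signSum ε (fun j => feature ρ (W i) m (x j)) := by
      simp only [signSum, network, Finset.mul_sum]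
      rw [Finset.sum_comm]
      refine Finset.sum_congr rfl fun m _ => Finset.sum_congr rfl fun j _ => by ring
    rw [h1]
    calc _ ≤ ∑ _m : Fin M, C₄ * (|ρ 0| * |signSum ε fun _ => 1| + ⨆ o, |signSum ε (h o)|) := by
          refine Finset.sum_le_sum fun m _ => (le_abs_self _).trans ?_
          rw [abs_mul]
          refine mul_le_mul ((norm_le_pi_norm (v i) m).trans (hv i)) ?_ (abs_nonneg _) hC₄
          have h2 : (fun j => feature ρ (W i) m (x j)) =
              fun j => ρ 0 * 1 + h (some (i, m)) j := by
            ext j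
            simp [hh, hw, feature]
          rw [h2, signSum_add, signSum_const_mul, ← abs_mul]
          exact (abs_add_le _ _).trans (add_le_add_right
            (le_iSup_of_finite (fun o => |signSum ε (h o)|) (some (i, m))) _)
      _ = _ := by simp [mul_assoc]
  have hcontr := sum_iSup_abs_signSum_le h (fun o j => L * inner ℝ (w o) (x j)) none
    (by ext j; simp [hh, hw]) fun j o o' => by
      have := hρ.dist_le_mul (inner ℝ (w o) (x j)) (inner ℝ (w o') (x j))
      rw [Real.dist_eq, Real.dist_eq] at this
      rw [← mul_sub, abs_mul, abs_of_nonneg L.coe_nonneg]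
      simpa [hh] using this
  simp only [signSum_const_mul, ← Real.mul_iSup_of_nonneg L.coe_nonneg, ← Finset.mul_sum]
    at hcontr
  have hlin := sum_iSup_signSum_inner_le w x C₁ C₃ hC₁ hC₃ hx hwn
  calc _ ≤ ∑ ε : Fin n → ℤˣ,
        M * C₄ * (|ρ 0| * |signSum ε fun _ => 1| + ⨆ o, |signSum ε (h o)|) :=
        Finset.sum_le_sum fun ε _ => hpt ε
    _ = M * C₄ * (|ρ 0| * ∑ ε : Fin n → ℤˣ, |signSum ε fun _ => 1| +
        ∑ ε : Fin n → ℤˣ, ⨆ o, |signSum ε (h o)|) := by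
        rw [← Finset.mul_sum, Finset.sum_add_distrib, ← Finset.mul_sum]
    _ ≤ M * C₄ * (|ρ 0| * (2 ^ n * √n) + 2 * (L * (2 ^ n * (C₁ * C₃ * √n)))) := by
        refine mul_le_mul_of_nonneg_left ?_ (by positivity)
        refine add_le_add
          (mul_le_mul_of_nonneg_left (sum_abs_signSum_one_le n) (abs_nonneg _))
          (hcontr.trans ?_)
        have := mul_le_mul_of_nonneg_left hlin L.coe_nonneg
        linarith
    _ = _ := by ring

/-- Rademacher complexity of the logistic losses of a finite class of bounded predictors. -/
theorem sum_iSup_signSum_logisticLoss_le {ι : Type*} [Finite ι] [Nonempty ι] {n : ℕ} (B R : ℝ)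
    (t : ι → Fin n → ℝ) (ht : ∀ i j, |t i j| ≤ B) (y : Fin n → ℝ)
    (hy : ∀ j, y j = -1 ∨ y j = 1)
    (hR : ∑ ε : Fin n → ℤˣ, ⨆ i, signSum ε (t i) ≤ 2 ^ n * R) :
    ∑ ε : Fin n → ℤˣ, ⨆ i, signSum ε (fun j => logisticLoss (t i j) (y j)) ≤
      2 ^ n * ((1 + Real.exp (-B))⁻¹ * R) := by
  have hκ : 0 ≤ (1 + Real.exp (-B))⁻¹ := by positivity
  have h1 := sum_iSup_signSum_le (fun _ => 0) (fun i j => logisticLoss (t i j) (y j))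
    (fun i j => (1 + Real.exp (-B))⁻¹ * t i j) fun j i k => by
      rw [← mul_sub, abs_mul, abs_of_nonneg hκ]
      exact abs_logisticLoss_sub_le (hy j) (ht i j) (ht k j)
  simp only [zero_add, signSum_const_mul, ← Real.mul_iSup_of_nonneg hκ, ← Finset.mul_sum] at h1
  refine h1.trans ((mul_le_mul_of_nonneg_left hR hκ).trans (le_of_eq (by ring)))

end Network

/-! ### Truncated losses and the uniform bound over the whole class. -/

section Risk

variable {D M : ℕ}

/-- The parameters `(W, v)` admissible in `hypothesisClass`. -/
def paramSet (M : ℕ) (ρ : ℝ → ℝ) (X : Set (Input D)) (C₃ C₄ d : ℝ) :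
    Set ((Fin M → Input D) × (Fin M → ℝ)) :=
  {p | (∀ m, ‖p.1 m‖ ≤ C₃) ∧ ‖p.2‖ ≤ C₄ ∧ ∀ x ∈ X, d ^ 2 ≤ diversity ρ p.1 x}

theorem continuous_network {ρ : ℝ → ℝ} (hρ : Continuous ρ) :
    Continuous fun q : ((Fin M → Input D) × (Fin M → ℝ)) × Input D =>
      network ρ q.1.1 q.1.2 q.2 := by
  unfold network feature
  fun_prop

theorem continuous_logisticLoss : Continuous fun q : ℝ × ℝ => logisticLoss q.1 q.2 := by
  unfold logisticLoss
  exact Continuous.log (by fun_prop) fun q => (one_add_exp_pos _).ne'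

/-- The logistic loss of the network with parameters `p`, set to zero outside the set `E` of
admissible labelled inputs. -/
noncomputable def truncLoss (ρ : ℝ → ℝ) (E : Set (Input D × ℝ))
    (p : (Fin M → Input D) × (Fin M → ℝ)) : Input D × ℝ → ℝ :=
  E.indicator fun z => logisticLoss (network ρ p.1 p.2 z.1) z.2

theorem measurable_truncLoss {ρ : ℝ → ℝ} (hρ : Continuous ρ) {E : Set (Input D × ℝ)}
    (hE : MeasurableSet E) (p : (Fin M → Input D) × (Fin M → ℝ)) :
    Measurable (truncLoss ρ E p) := by
  refine Measurable.indicator (Continuous.measurable ?_) hE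
  exact continuous_logisticLoss.comp (((continuous_network hρ).comp
    (by fun_prop : Continuous fun z : Input D × ℝ => (p, z.1))).prodMk continuous_snd)

theorem continuous_truncLoss {ρ : ℝ → ℝ} (hρ : Continuous ρ) (E : Set (Input D × ℝ))
    (z : Input D × ℝ) :
    Continuous fun p : (Fin M → Input D) × (Fin M → ℝ) => truncLoss ρ E p z := by
  by_cases hz : z ∈ E
  · simp only [truncLoss, Set.indicator_of_mem hz]
    exact continuous_logisticLoss.comp (((continuous_network hρ).comp
      (by fun_prop : Continuous fun p : (Fin M → Input D) × (Fin M → ℝ) => (p, z.1))).prodMk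
      continuous_const)
  · simp only [truncLoss, Set.indicator_of_notMem hz]
    exact continuous_const

theorem risk_eq_integral_truncLoss {Q : Measure (Input D × ℝ)} {ρ : ℝ → ℝ}
    {E : Set (Input D × ℝ)} (hQE : ∀ᵐ z ∂Q, z ∈ E) (p : (Fin M → Input D) × (Fin M → ℝ)) :
    risk Q (network ρ p.1 p.2) = ∫ z, truncLoss ρ E p z ∂Q := by
  refine integral_congr_ae ?_
  filter_upwards [hQE] with z hz
  rw [truncLoss, Set.indicator_of_mem hz]

theorem empiricalRisk_eq_sum_truncLoss {N : ℕ} {ρ : ℝ → ℝ} {E : Set (Input D × ℝ)}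
    {S : Fin N → Input D × ℝ} (hS : ∀ j, S j ∈ E) (p : (Fin M → Input D) × (Fin M → ℝ)) :
    empiricalRisk S (network ρ p.1 p.2) = 1 / (N : ℝ) * ∑ j, truncLoss ρ E p (S j) := by
  unfold empiricalRisk
  congr 1
  refine Finset.sum_congr rfl fun j _ => ?_
  rw [truncLoss, Set.indicator_of_mem (hS j)]

variable {N : ℕ} {ρ : ℝ → ℝ} {L : NNReal} {C₁ C₃ C₄ d : ℝ} {X : Set (Input D)}

/-- Truncation makes the bound hold at every `z`, as the deviation bounds demand; off `E` the
diversity constraint and the label condition may both fail. -/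
theorem truncLoss_mem_Icc (hM : 2 ≤ M) (hρ_nonneg : ∀ t, 0 ≤ ρ t) (hρ_lip : LipschitzWith L ρ)
    (hX : ∀ x ∈ X, ‖x‖ ≤ C₁) {E : Set (Input D × ℝ)}
    (hEX : ∀ z ∈ E, z.1 ∈ X ∧ (z.2 = -1 ∨ z.2 = 1))
    {p : (Fin M → Input D) × (Fin M → ℝ)} (hp : p ∈ paramSet M ρ X C₃ C₄ d) (z : Input D × ℝ) :
    truncLoss ρ E p z ∈
      Set.Icc 0 (Real.log (1 + Real.exp (√(constJ M ρ L C₁ C₃ C₄ d)))) := by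
  by_cases hz : z ∈ E
  · rw [truncLoss, Set.indicator_of_mem hz]
    obtain ⟨hx, hy⟩ := hEX z hz
    exact logisticLoss_mem_Icc hy
      (abs_network_le hM hρ_nonneg hρ_lip hp.1 hp.2.1 (hX _ hx) (hp.2.2 _ hx))
  · rw [truncLoss, Set.indicator_of_notMem hz]
    exact ⟨le_rfl, Real.log_nonneg (by linarith [Real.exp_pos (√(constJ M ρ L C₁ C₃ C₄ d))])⟩

/-- Dominated convergence with the constant bound of `truncLoss_mem_Icc`; it serves to extend the
deviation bound from a dense sequence of parameters. -/
theorem continuous_integral_truncLoss (hM : 2 ≤ M) (hρ_nonneg : ∀ t, 0 ≤ ρ t)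
    (hρ_lip : LipschitzWith L ρ) (hX : ∀ x ∈ X, ‖x‖ ≤ C₁) {E : Set (Input D × ℝ)}
    (hE : MeasurableSet E) (hEX : ∀ z ∈ E, z.1 ∈ X ∧ (z.2 = -1 ∨ z.2 = 1))
    (Q : Measure (Input D × ℝ)) [IsProbabilityMeasure Q] :
    Continuous fun p : paramSet M ρ X C₃ C₄ d => ∫ z, truncLoss ρ E p.1 z ∂Q := by
  refine continuous_of_dominated
    (bound := fun _ => Real.log (1 + Real.exp (√(constJ M ρ L C₁ C₃ C₄ d))))
    (fun p => (measurable_truncLoss hρ_lip.continuous hE p.1).aestronglyMeasurable)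
    (fun p => Filter.Eventually.of_forall fun z => ?_) (integrable_const _)
    (Filter.Eventually.of_forall fun z =>
      (continuous_truncLoss hρ_lip.continuous E z).comp continuous_subtype_val)
  have := truncLoss_mem_Icc (L := L) hM hρ_nonneg hρ_lip hX hEX p.2 z
  rw [Real.norm_of_nonneg this.1]
  exact this.2

/-- Rademacher complexity of the losses of a finite class of networks. -/
theorem sum_iSup_signSum_truncLoss_le (hM : 2 ≤ M) (hρ_nonneg : ∀ t, 0 ≤ ρ t)
    (hρ_lip : LipschitzWith L ρ) (hX : ∀ x ∈ X, ‖x‖ ≤ C₁) (hC₁ : 0 ≤ C₁) (hC₃ : 0 ≤ C₃)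
    (hC₄ : 0 ≤ C₄) {E : Set (Input D × ℝ)}
    (hEX : ∀ z ∈ E, z.1 ∈ X ∧ (z.2 = -1 ∨ z.2 = 1)) {ι : Type*} [Finite ι] [Nonempty ι]
    (p : ι → paramSet M ρ X C₃ C₄ d) {S : Fin N → Input D × ℝ} (hS : ∀ j, S j ∈ E) :
    ∑ ε : Fin N → ℤˣ, ⨆ i, signSum ε (fun j => truncLoss ρ E (p i).1 (S j)) ≤
      2 ^ N * ((1 + Real.exp (-√(constJ M ρ L C₁ C₃ C₄ d)))⁻¹ *
        (M * C₄ * ((|ρ 0| + 2 * L * (C₁ * C₃)) * √N))) := by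
  have h := sum_iSup_signSum_logisticLoss_le (√(constJ M ρ L C₁ C₃ C₄ d)) _
    (fun i j => network ρ (p i).1.1 (p i).1.2 (S j).1)
    (fun i j => abs_network_le hM hρ_nonneg hρ_lip (p i).2.1 (p i).2.2.1
      (hX _ (hEX _ (hS j)).1) ((p i).2.2.2 _ (hEX _ (hS j)).1))
    (fun j => (S j).2) (fun j => (hEX _ (hS j)).2)
    (sum_iSup_signSum_network_le hρ_lip hC₁ hC₃ hC₄ (fun i => (p i).1.1) (fun i => (p i).1.2)
      (fun i => (p i).2.1) (fun i => (p i).2.2.1) (fun j => (S j).1)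
      (fun j => hX _ (hEX _ (hS j)).1))
  simpa only [truncLoss, Set.indicator_of_mem (hS _)] using h

/-- With probability at least `1 - δ`, the excess of the deviation of the risk from the empirical
risk over that of a fixed member of the class is bounded uniformly over the class. -/
theorem exists_measurableSet_uniform_deviation_le (hM : 2 ≤ M) (hN : 1 ≤ N)
    (hρ_nonneg : ∀ t, 0 ≤ ρ t) (hρ_lip : LipschitzWith L ρ) (hX : ∀ x ∈ X, ‖x‖ ≤ C₁)
    (hC₁ : 0 ≤ C₁) (hC₃ : 0 ≤ C₃) (hC₄ : 0 ≤ C₄) {E : Set (Input D × ℝ)}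
    (hE : MeasurableSet E) (hEX : ∀ z ∈ E, z.1 ∈ X ∧ (z.2 = -1 ∨ z.2 = 1))
    (Q : Measure (Input D × ℝ)) [IsProbabilityMeasure Q] (hQE : ∀ᵐ z ∂Q, z ∈ E)
    (p₀ : paramSet M ρ X C₃ C₄ d) {δ : ℝ} (hδ0 : 0 < δ) (hδ1 : δ < 1) :
    ∃ G : Set (Fin N → Input D × ℝ), MeasurableSet G ∧
      ENNReal.ofReal (1 - δ) ≤ Measure.pi (fun _ : Fin N => Q) G ∧
      ∀ S ∈ G, (∀ j, S j ∈ E) ∧ ∀ p : paramSet M ρ X C₃ C₄ d,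
        ∑ j, (∫ z, truncLoss ρ E p.1 z ∂Q - truncLoss ρ E p.1 (S j)) -
          ∑ j, (∫ z, truncLoss ρ E p₀.1 z ∂Q - truncLoss ρ E p₀.1 (S j)) ≤
        2 * ((1 + Real.exp (-√(constJ M ρ L C₁ C₃ C₄ d)))⁻¹ *
          (M * C₄ * ((|ρ 0| + 2 * L * (C₁ * C₃)) * √N))) +
        Real.log (1 + Real.exp (√(constJ M ρ L C₁ C₃ C₄ d))) *
          √(2 * N * Real.log (1 / δ)) := by
  set thr : ℝ := 2 * ((1 + Real.exp (-√(constJ M ρ L C₁ C₃ C₄ d)))⁻¹ *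
          (M * C₄ * ((|ρ 0| + 2 * L * (C₁ * C₃)) * √N))) +
        Real.log (1 + Real.exp (√(constJ M ρ L C₁ C₃ C₄ d))) *
          √(2 * N * Real.log (1 / δ)) with hthr
  have : Nonempty (paramSet M ρ X C₃ C₄ d) := ⟨p₀⟩
  set θ : ℕ → paramSet M ρ X C₃ C₄ d := TopologicalSpace.denseSeq _ with hθ
  set EN : Set (Fin N → Input D × ℝ) := Set.univ.pi fun _ => E with hEN
  have hENm : MeasurableSet EN := MeasurableSet.univ_pi fun _ => hE
  have hEN1 : Measure.pi (fun _ : Fin N => Q) EN = 1 := by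
    rw [hEN, Measure.pi_pi]
    simp [(mem_ae_iff_prob_eq_one hE).1 hQE]
  have hENae : ∀ᵐ S ∂(Measure.pi fun _ : Fin N => Q), ∀ j, S j ∈ E := by
    filter_upwards [(mem_ae_iff_prob_eq_one hENm).2 hEN1] with S hS j
    exact hS j (Set.mem_univ j)
  -- Only a dense sequence of parameters is tested, so `Bad` is a countable union and measurable.
  set Bad : Set (Fin N → Input D × ℝ) := {S | ∃ i, thr <
    ∑ j, (∫ z, truncLoss ρ E (θ i).1 z ∂Q - truncLoss ρ E (θ i).1 (S j)) -
      ∑ j, (∫ z, truncLoss ρ E p₀.1 z ∂Q - truncLoss ρ E p₀.1 (S j))} with hBad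
  have hmeas := fun p : paramSet M ρ X C₃ C₄ d => measurable_truncLoss hρ_lip.continuous hE p.1
  have hBadm : MeasurableSet Bad := by
    rw [hBad, Set.ofPred_exists]
    refine MeasurableSet.iUnion fun i => measurableSet_lt measurable_const ?_
    have h1 := hmeas (θ i)
    have h2 := hmeas p₀
    fun_prop
  have hBadδ : Measure.pi (fun _ : Fin N => Q) Bad ≤ ENNReal.ofReal δ :=
    measure_uniform_deviation_le_of_countable Q hN (fun i => truncLoss ρ E (θ i).1)
      (fun i => hmeas (θ i)) (truncLoss ρ E p₀.1) (hmeas p₀) _ _ δ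
      (Real.log_pos (by linarith [Real.exp_pos (√(constJ M ρ L C₁ C₃ C₄ d))]))
      (fun i => truncLoss_mem_Icc hM hρ_nonneg hρ_lip hX hEX (θ i).2)
      (truncLoss_mem_Icc hM hρ_nonneg hρ_lip hX hEX p₀.2)
      (fun k => by
        filter_upwards [hENae] with S hS
        exact sum_iSup_signSum_truncLoss_le hM hρ_nonneg hρ_lip hX hC₁ hC₃ hC₄ hEX
          (fun i : Fin (k + 1) => θ i) hS)
      hδ0 hδ1
  refine ⟨EN \ Bad, hENm.diff hBadm, ?_, fun S hS => ⟨fun j => hS.1 j (Set.mem_univ j), ?_⟩⟩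
  · rw [ENNReal.ofReal_sub _ hδ0.le, ENNReal.ofReal_one]
    calc _ ≤ Measure.pi (fun _ : Fin N => Q) EN - Measure.pi (fun _ : Fin N => Q) Bad := by
          rw [hEN1]
          exact tsub_le_tsub_left hBadδ _
      _ ≤ _ := le_measure_sdiff
  · have hcont : Continuous fun p : paramSet M ρ X C₃ C₄ d =>
        ∑ j, (∫ z, truncLoss ρ E p.1 z ∂Q - truncLoss ρ E p.1 (S j)) -
          ∑ j, (∫ z, truncLoss ρ E p₀.1 z ∂Q - truncLoss ρ E p₀.1 (S j)) := by
      refine Continuous.sub (continuous_finsetSum _ fun j _ => ?_) continuous_const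
      exact (continuous_integral_truncLoss hM hρ_nonneg hρ_lip hX hE hEX Q).sub
        ((continuous_truncLoss hρ_lip.continuous E (S j)).comp continuous_subtype_val)
    -- For a fixed sample the deviation is continuous in the parameters, so the set where the bound
    -- holds is closed and contains the dense sequence.
    intro p
    refine (TopologicalSpace.denseRange_denseSeq (paramSet M ρ X C₃ C₄ d)).induction_on
      p (isClosed_le hcont continuous_const) fun i => ?_
    by_contra hlt
    exact hS.2 ⟨i, not_le.1 hlt⟩

end Risk

end DiverseNet

/-! ### Excess risk of an empirical minimizer. -/

open DiverseNet in
theorem mainTheorem3 {D M N : ℕ} (hM : 2 ≤ M) (hN : 1 ≤ N)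
    (ρ : ℝ → ℝ) (L : NNReal) (hρ_nonneg : ∀ t, 0 ≤ ρ t) (hρ_lip : LipschitzWith L ρ)
    (C₁ C₃ C₄ d : ℝ)
    (X : Set (DiverseNet.Input D)) (hX : ∀ x ∈ X, ‖x‖ ≤ C₁)
    (Q : MeasureTheory.Measure (DiverseNet.Input D × ℝ)) [MeasureTheory.IsProbabilityMeasure Q]
    (hQ : ∀ᵐ z ∂Q, z.1 ∈ X ∧ (z.2 = -1 ∨ z.2 = 1))
    (fstar : DiverseNet.Input D → ℝ)
    (hfstar_mem : fstar ∈ DiverseNet.hypothesisClass M ρ X C₃ C₄ d)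
    (hfstar_min : IsMinOn (DiverseNet.risk Q) (DiverseNet.hypothesisClass M ρ X C₃ C₄ d) fstar)
    (δ : ℝ) (hδ0 : 0 < δ) (hδ1 : δ < 1) :
    ∃ G : Set (Fin N → DiverseNet.Input D × ℝ), MeasurableSet G ∧
      ENNReal.ofReal (1 - δ) ≤ MeasureTheory.Measure.pi (fun _ : Fin N => Q) G ∧
      ∀ S ∈ G, ∀ fhat ∈ DiverseNet.hypothesisClass M ρ X C₃ C₄ d,
        IsMinOn (DiverseNet.empiricalRisk S) (DiverseNet.hypothesisClass M ρ X C₃ C₄ d) fhat →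
        DiverseNet.risk Q fhat - DiverseNet.risk Q fstar ≤
          DiverseNet.constA M ρ L C₁ C₃ C₄ /
              ((1 + Real.exp (-Real.sqrt (DiverseNet.constJ M ρ L C₁ C₃ C₄ d))) *
                Real.sqrt N) +
            Real.log (1 + Real.exp (Real.sqrt (DiverseNet.constJ M ρ L C₁ C₃ C₄ d))) *
              Real.sqrt (2 * Real.log (2 / δ) / N) := by
  -- `X` need not be measurable, so the admissible set is replaced by a measurable subset of full
  -- measure.
  obtain ⟨E, hQE, hE, hEX⟩ := Filter.IsMeasurablyGenerated.exists_measurable_subset hQ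
  have hEX : ∀ z ∈ E, z.1 ∈ X ∧ (z.2 = -1 ∨ z.2 = 1) := fun z hz => hEX hz
  replace hQE : ∀ᵐ z ∂Q, z ∈ E := hQE
  obtain ⟨z₀, hz₀⟩ := hQE.exists
  have hC₁ : 0 ≤ C₁ := (norm_nonneg _).trans (hX _ (hEX _ hz₀).1)
  obtain ⟨W₀, v₀, hW₀, hv₀, hd₀, rfl⟩ := hfstar_mem
  have hC₃ : 0 ≤ C₃ := (norm_nonneg _).trans (hW₀ ⟨0, by omega⟩)
  have hC₄ : 0 ≤ C₄ := (norm_nonneg _).trans hv₀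
  obtain ⟨G, hGm, hGδ, hG⟩ := exists_measurableSet_uniform_deviation_le hM hN hρ_nonneg hρ_lip hX
    hC₁ hC₃ hC₄ hE hEX Q hQE ⟨(W₀, v₀), hW₀, hv₀, hd₀⟩ hδ0 hδ1
  refine ⟨G, hGm, hGδ, ?_⟩
  rintro S hS _ ⟨W, v, hW, hv, hd, rfl⟩ hmin
  obtain ⟨hSE, hdev⟩ := hG S hS
  have hdev := hdev ⟨(W, v), hW, hv, hd⟩
  have hemp := hmin ⟨W₀, v₀, hW₀, hv₀, hd₀, rfl⟩
  have hN0 : (0 : ℝ) < N := by exact_mod_cast hN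
  simp only [Set.mem_ofPred_eq] at hemp
  rw [empiricalRisk_eq_sum_truncLoss hSE (W, v), empiricalRisk_eq_sum_truncLoss hSE (W₀, v₀)]
    at hemp
  have hemp := le_of_mul_le_mul_left hemp (by positivity)
  rw [risk_eq_integral_truncLoss hQE (W, v), risk_eq_integral_truncLoss hQE (W₀, v₀)]
  simp only [Finset.sum_sub_distrib, Finset.sum_const, Finset.card_univ, Fintype.card_fin,
    nsmul_eq_mul] at hdev
  set J := √(constJ M ρ L C₁ C₃ C₄ d)
  have hlog2 : Real.log (1 / δ) ≤ Real.log (2 / δ) := by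
    apply Real.log_le_log (by positivity)
    gcongr
    norm_num
  have hc : 0 ≤ Real.log (1 + Real.exp J) := Real.log_nonneg (by linarith [Real.exp_pos J])
  have hsq : √(N : ℝ) * √N = N := Real.mul_self_sqrt hN0.le
  have hsq0 : 0 < √(N : ℝ) := Real.sqrt_pos.2 hN0
  have hκ := one_add_exp_pos (-J)
  have hterm1 : 2 * ((1 + Real.exp (-J))⁻¹ *
      (M * C₄ * ((|ρ 0| + 2 * L * (C₁ * C₃)) * √N))) ≤
      N * (constA M ρ L C₁ C₃ C₄ / ((1 + Real.exp (-J)) * √N)) := by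
    -- The constant `A` is twice what the one-sided argument needs.
    have h1 : (N : ℝ) * (constA M ρ L C₁ C₃ C₄ / ((1 + Real.exp (-J)) * √N)) =
        2 * (2 * ((1 + Real.exp (-J))⁻¹ * (M * C₄ * ((|ρ 0| + 2 * L * (C₁ * C₃)) * √N)))) := by
      have h3 : ∀ s : ℝ, 0 < s → s * s * (constA M ρ L C₁ C₃ C₄ / ((1 + Real.exp (-J)) * s)) =
          2 * (2 * ((1 + Real.exp (-J))⁻¹ *
            (M * C₄ * ((|ρ 0| + 2 * L * (C₁ * C₃)) * s)))) := by
        intro s hs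
        unfold constA
        field_simp
        ring
      simpa only [hsq] using h3 _ hsq0
    rw [h1]
    have h2 : 0 ≤ 2 * ((1 + Real.exp (-J))⁻¹ *
      (M * C₄ * ((|ρ 0| + 2 * L * (C₁ * C₃)) * √N))) := by positivity
    linarith
  have hterm2 : √(2 * N * Real.log (1 / δ)) ≤ N * √(2 * Real.log (2 / δ) / N) := by
    rw [← Real.sqrt_sq hN0.le, ← Real.sqrt_mul (sq_nonneg _), Real.sqrt_sq hN0.le]
    apply Real.sqrt_le_sqrt
    have : (N : ℝ) ^ 2 * (2 * Real.log (2 / δ) / N) = 2 * N * Real.log (2 / δ) := by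
      field_simp
    rw [this]
    gcongr
  have hterm2 := mul_le_mul_of_nonneg_left hterm2 hc
  -- After scaling by `N`, the claim combines `hdev`, empirical minimality `hemp` and the two term
  -- bounds.
  refine le_of_mul_le_mul_left ?_ hN0
  rw [mul_add, mul_sub]
  linarith
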